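/- **Proposition.** Let $n\ge 1$ and let $\alpha=(\alpha_1,\ldots,\alpha_k)$ be a composition of $n$, i.e. a sequence of positive integers with $\alpha_1+\cdots+\alpha_k=n$. For $1\le i\le k$ let $$B_i=\{\alpha_1+\cdots+\alpha_{i-1}+1,\ \ldots,\ \alpha_1+\cdots+\alpha_{i-1}+\alpha_i\}\subseteq [n]=\{1,\ldots,n\}.$$ A permutation $\pi$ of $[n]$ is called $\alpha$-separated if, for every cycle of $\pi$ (fixed points being cycles of length one), all elements of the cycle lie in the same block $B_i$ for some $i$. Let $p^{(n)}_\alpha$ be the number of ordered pairs $(s,t)$ of $n$-cycles on $[n]$ (for $n=1$ the identity is the only $1$-cycle) whose product $st$ is $\alpha$-separated. Then $$p^{(n)}_{\alpha}=\frac{\prod_{i=1}^k \alpha_i!}{(n+1-k)!}\,(n-1)!\,(n-k)!=\frac{(n-1)!\,\prod_{i=1}^k \alpha_i!}{n+1-k}.$$ -/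

import Mathlib

open scoped Nat

/-- A permutation of `[n]`, modelled on `Fin n`, is an `n`-cycle if all `n` points form a single
cycle. For `n = 1` this is the identity, which is the only 1-cycle on a single point
(`Equiv.Perm.IsCycle` excludes it). -/
def IsLongCycle {n : ℕ} (s : Equiv.Perm (Fin n)) : Prop :=
  s.IsCycleOn Set.univ

/-- The block `B_i` of consecutive elements of `[n]` determined by a composition `α` of `n`: it
starts after the first `α_1 + ⋯ + α_{i-1}` elements and has `α_i` elements. -/
def compositionBlock {n : ℕ} (α : Composition n) (i : Fin α.length) : Set (Fin n) :=
  {x | α.sizeUpTo i ≤ (x : ℕ) ∧ (x : ℕ) < α.sizeUpTo i + α.blocksFun i}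

/-- `π` is `α`-separated: every cycle of `π` (fixed points included) lies inside one block. -/
def IsSeparatedBy {n : ℕ} (α : Composition n) (π : Equiv.Perm (Fin n)) : Prop :=
  ∀ x : Fin n, ∃ i : Fin α.length, {y | π.SameCycle x y} ⊆ compositionBlock α i

/-- The number of ordered pairs of `n`-cycles whose product is `α`-separated. -/
noncomputable def separatedPairCount {n : ℕ} (α : Composition n) : ℕ :=
  Nat.card {p : Equiv.Perm (Fin n) × Equiv.Perm (Fin n) //
    IsLongCycle p.1 ∧ IsLongCycle p.2 ∧ IsSeparatedBy α (p.1 * p.2)}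

/-! Writing t = τ and s = (τρ)⁻¹ gives st = ρ⁻¹, so the pairs to count are full cycles τ and
block-preserving ρ with τρ a full cycle. Cutting a permutation at one point turns "full cycle" into
"the partial map is absorbing", and `card_absorbing_perm` gives the probability of that for a random
permutation.

Through landing maps (`card_absorbing_perm_mul_card`) this applies block by block: for fixed τ, the
random ρ may be replaced by a random section e marking one point per block
(`prod_card_mul_card_absorbing`). With a the cutting point, only sections marking a contribute, and
absorption then depends on τ only at the k - 1 other marked points. Reshuffling τ on the remaining n
+ 1 - k points makes it a full cycle with probability 1/(n + 1 - k)
(`card_mul_card_isCycleOn_sectionStep`), while (n - 1)! times the size of the block of a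
permutations satisfy the absorption condition (`card_absorbing_sectionStep`). Summing over e gives
the formula. -/

/-! ### Absorbing partial maps -/

/-- The partial map `g` absorbs if no orbit stays in `X` forever: iterating `g` from any point
eventually reaches `none`. -/
def IsAbsorbing {X : Type*} (g : X → Option X) : Prop :=
  WellFounded fun y x => g x = some y

theorem IsAbsorbing.exists_eq_none {X : Type*} [Nonempty X] {g : X → Option X}
    (hg : IsAbsorbing g) : ∃ x, g x = none := by
  obtain ⟨x, -, hx⟩ := hg.has_min Set.univ Set.univ_nonempty
  refine ⟨x, ?_⟩
  cases h : g x with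
  | none => rfl
  | some y => exact absurd h (hx y trivial)

theorem isAbsorbing_const_iff {X : Type*} [Nonempty X] {v : Option X} :
    IsAbsorbing (fun _ : X => v) ↔ v = none := by
  refine ⟨fun h => h.exists_eq_none.elim fun _ => id, ?_⟩
  rintro rfl
  exact ⟨fun x => ⟨x, fun y hy => by simp at hy⟩⟩

/-- An infinite orbit of `g` would be carried by `p` to an infinite orbit of `g'`. Steps landing
where `g` stops lie on no infinite orbit, so `p` need not respect them. -/
theorem IsAbsorbing.of_hom {X Y : Type*} {g : X → Option X} {g' : Y → Option Y}
    (hg' : IsAbsorbing g') (p : X → Y)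
    (hp : ∀ x y, g x = some y → g y = none ∨ g' (p x) = some (p y)) : IsAbsorbing g := by
  have key : ∀ y x, p x = y → Acc (fun y x => g x = some y) x := by
    intro y
    induction y using hg'.induction with
    | _ y ih =>
      rintro x rfl
      refine ⟨x, fun z hz => ?_⟩
      rcases hp x z hz with h | h
      · exact ⟨z, fun u hu => by simp [h] at hu⟩
      · exact ih _ h z rfl
  exact ⟨fun x => key _ x rfl⟩

theorem IsAbsorbing.mono {X : Type*} {g g' : X → Option X} (hg' : IsAbsorbing g')
    (hp : ∀ x y, g x = some y → g' x = some y) : IsAbsorbing g :=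
  hg'.of_hom id fun x y h => Or.inr (hp x y h)

theorem isAbsorbing_conj_iff {X Y : Type*} (e : X ≃ Y) {g : X → Option X} {g' : Y → Option Y}
    (h : ∀ x, g' (e x) = (g x).map e) : IsAbsorbing g ↔ IsAbsorbing g' := by
  refine ⟨fun H => H.of_hom e.symm fun x y hxy => Or.inr ?_,
    fun H => H.of_hom e fun x y hxy => Or.inr ?_⟩
  · have := h (e.symm x)
    rw [e.apply_symm_apply, hxy] at this
    obtain ⟨z, hz, hz'⟩ := Option.map_eq_some_iff.1 this.symm
    rw [hz, ← hz', e.symm_apply_apply]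
  · rw [h, hxy]; rfl

/-- The point `none` of `Option B` is never a value of the map, so it lies on no cycle and can be
deleted. -/
theorem isAbsorbing_option_iff {B : Type*} (v : Option B → Option B) :
    IsAbsorbing (fun x => (v x).map some) ↔ IsAbsorbing (fun y => v (some y)) := by
  constructor
  · intro H
    exact H.of_hom some fun x y hxy => Or.inr (by simp [hxy])
  · intro H
    have hs : ∀ y : B, Acc (fun y x => (v x).map some = some y) (some y) := by
      intro y
      induction y using H.induction with
      | _ y ih =>
        refine ⟨_, fun z hz => ?_⟩
        obtain ⟨u, hu, rfl⟩ := Option.map_eq_some_iff.1 hz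
        exact ih u hu
    refine ⟨fun x => ⟨x, fun z hz => ?_⟩⟩
    obtain ⟨u, hu, rfl⟩ := Option.map_eq_some_iff.1 hz
    exact hs u

/-! ### Absorption under a random permutation -/

-- Inductive step for `card_absorbing_perm`. A permutation of `Option B` is its value c at `none`
-- together with a permutation of B. For each c, `ih` counts the points other than c that `W` kills;
-- each point is omitted for exactly one c, so the sum over c is m times the full count.
open Classical in
theorem card_absorbing_perm_option {B : Type*} [Fintype B] [DecidableEq B] {m : ℕ}
    (hm : Fintype.card B = m)
    (ih : ∀ k, m = k + 1 → ∀ w : B → Option B,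
      (∑ σ : Equiv.Perm B, if IsAbsorbing (fun x => w (σ x)) then 1 else 0) =
        k ! * ∑ b, if w b = none then 1 else 0)
    (W : Option B → Option B) :
    (∑ σ : Equiv.Perm (Option B), if IsAbsorbing (fun x => (W (σ x)).map some) then 1 else 0) =
      m ! * ∑ b, if W b = none then 1 else 0 := by
  rw [← Equiv.sum_comp Equiv.Perm.decomposeOption.symm, Fintype.sum_prod_type]
  have h1 : ∀ c : Option B, (∑ π : Equiv.Perm B,
      if IsAbsorbing (fun x => (W (Equiv.Perm.decomposeOption.symm (c, π) x)).map some)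
        then 1 else 0) =
      ∑ π : Equiv.Perm B, if IsAbsorbing (fun y => W (Equiv.swap none c (some (π y))))
        then 1 else 0 := by
    intro c
    refine Finset.sum_congr rfl fun π _ => ?_
    have := isAbsorbing_option_iff (fun x => W (Equiv.Perm.decomposeOption.symm (c, π) x))
    simp only [this]
    simp
  simp only [h1]
  cases m with
  | zero =>
    have : IsEmpty B := Fintype.card_eq_zero_iff.1 hm
    have h2 : ∀ v : B → Option B, IsAbsorbing v := fun v => ⟨fun x => isEmptyElim x⟩
    have h3 : W none = none := by
      cases h : W none with
      | none => rfl
      | some y => exact isEmptyElim y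
    simp [h2, Finset.filter_singleton, show (default : Option B) = none from rfl, h3]
  | succ k =>
    have h2 : ∀ c : Option B, ((if W c = none then 1 else 0) +
        ∑ y, if W (Equiv.swap none c (some y)) = none then 1 else 0) =
        ∑ b, if W b = none then 1 else 0 := by
      intro c
      rw [← Equiv.sum_comp (Equiv.swap none c), Fintype.sum_option]
      simp
    simp only [fun c => ih k rfl (fun y => W (Equiv.swap none c (some y)))]
    rw [← Finset.mul_sum]
    have h3 := Finset.sum_congr rfl fun c (_ : c ∈ (Finset.univ : Finset (Option B))) => h2 c
    rw [Finset.sum_add_distrib] at h3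
    simp only [Finset.sum_const, Finset.card_univ, Fintype.card_option, hm, smul_eq_mul] at h3
    rw [Nat.factorial_succ, mul_comm (k + 1), mul_assoc]
    congr 1
    linarith

open Classical in
/-- For a map `w : B → B ∪ {∞}`, the proportion of permutations `σ` for which `w ∘ σ` leads every
point to `∞` is the proportion of points that `w` sends to `∞`. -/
theorem card_absorbing_perm (m : ℕ) : ∀ (B : Type*) [Fintype B] [DecidableEq B] (w : B → Option B),
    Fintype.card B = m + 1 →
    (∑ σ : Equiv.Perm B, if IsAbsorbing (fun x => w (σ x)) then 1 else 0) =
      m ! * ∑ b, if w b = none then 1 else 0 := by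
  induction m with
  | zero =>
    intro B _ _ w hB
    obtain ⟨b, hb⟩ := Fintype.card_eq_one_iff.1 hB
    have : Unique B := ⟨⟨b⟩, hb⟩
    have h : ∀ σ : Equiv.Perm B, IsAbsorbing (fun x => w (σ x)) ↔ w default = none := by
      intro σ
      rw [← isAbsorbing_const_iff (X := B)]
      simp [Subsingleton.elim _ (default : B)]
    simp only [h, Finset.univ_unique, Finset.sum_singleton]
    simp
  | succ m ih =>
    intro B _ _ w hB
    have : Nonempty B := Fintype.card_pos_iff.1 (by omega)
    by_cases hd : ∃ x, w x = none
    -- As `w` kills some point and B is finite, it misses some b, which can play the role of the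
    -- extra point of `Option`.
    · obtain ⟨b, hb⟩ : ∃ b, ∀ x, w x ≠ some b := by
        by_contra! H
        choose F hF using H
        have hinj : Function.Injective F := fun x y hxy => by
          have := hF x
          rw [hxy, hF y] at this
          exact (Option.some_injective _ this).symm
        obtain ⟨x, hx⟩ := hd
        obtain ⟨y, rfl⟩ := Finite.injective_iff_surjective.1 hinj x
        simp [hF] at hx
      let e : Option {x // x ≠ b} ≃ B := Equiv.optionSubtypeNe b
      have hW : ∀ x : Option {x // x ≠ b}, ∃ v : Option {x // x ≠ b},
          w (e x) = (v.map some).map e := by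
        intro x
        cases h : w (e x) with
        | none => exact ⟨none, rfl⟩
        | some y =>
          have hy : y ≠ b := fun hy => hb _ (hy ▸ h)
          exact ⟨some ⟨y, hy⟩, by simp [e]⟩
      choose W hW using hW
      have hcard : Fintype.card {x // x ≠ b} = m + 1 := by
        simp [hB]
      have key := card_absorbing_perm_option hcard
        (fun k hk w => by
          obtain rfl : m = k := by omega
          exact ih _ w hcard) W
      rw [← Equiv.sum_comp e.permCongr, ← Equiv.sum_comp e]
      convert key using 3 with σ _ b'
      · refine Iff.symm (isAbsorbing_conj_iff e fun x => ?_)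
        simp [Equiv.permCongr_apply, hW]
      · simp [hW]
    · have h : ∀ σ : Equiv.Perm B, ¬ IsAbsorbing (fun x => w (σ x)) := fun σ H => by
        obtain ⟨x, hx⟩ := H.exists_eq_none
        exact hd ⟨_, hx⟩
      push Not at hd
      simp [h, hd]

/-! ### Landing maps and reshuffling part of the transitions -/

/-- If the states outside `D` are absorbed into `D` or `none`, then every state outside `D` can be
replaced by the place where its orbit lands. -/
theorem IsAbsorbing.exists_landing {X : Type*} {D : X → Prop} [DecidablePred D]
    {h : X → Option X} (H : IsAbsorbing fun x => if D x then none else h x) :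
    ∃ ρ : X → Option (Subtype D), (∀ d : Subtype D, ρ d = some d) ∧
      ∀ x, ¬ D x → ρ x = (h x).bind ρ := by
  let F : (x : X) → (∀ y, (if D x then none else h x) = some y → Option (Subtype D)) →
      Option (Subtype D) := fun x rec =>
    if hx : D x then some ⟨x, hx⟩ else
      match hh : h x with
      | none => none
      | some y => rec y (by rw [if_neg hx, hh])
  have hfix : ∀ x, H.fix F x = F x fun y _ => H.fix F y := fun x => H.fix_eq F x
  refine ⟨H.fix F, fun d => ?_, fun x hx => ?_⟩
  · rw [hfix]
    simp only [F]
    rw [dif_pos d.2]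
  · rw [hfix]
    simp only [F]
    rw [dif_neg hx]
    split <;> rename_i h1 <;> simp [h1]

/-- Off `D` the map is absorbing, so an infinite orbit of `g` meets `D` infinitely often and is an
infinite orbit of the return map on `D`. -/
theorem isAbsorbing_iff_landing {X : Type*} {D : X → Prop} [DecidablePred D]
    {h : X → Option X} (H : IsAbsorbing fun x => if D x then none else h x)
    {ρ : X → Option (Subtype D)} (hD : ∀ d : Subtype D, ρ d = some d)
    (hρ : ∀ x, ¬ D x → ρ x = (h x).bind ρ)
    {γ : Subtype D → Option X} {g : X → Option X} (hg : ∀ d : Subtype D, g d = γ d)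
    (hgh : ∀ x, ¬ D x → g x = h x) :
    IsAbsorbing g ↔ IsAbsorbing fun d => (γ d).bind ρ := by
  constructor
  · intro G
    have hreach : ∀ x (d : Subtype D), ρ x = some d →
        Relation.ReflTransGen (fun y x => g x = some y) (d : X) x := by
      intro x
      induction x using H.induction with
      | _ x ih =>
        intro d hd
        by_cases hx : D x
        · have := hD ⟨x, hx⟩
          rw [show ρ x = _ from this] at hd
          obtain rfl := Option.some_injective _ hd
          exact .refl
        · rw [hρ x hx] at hd
          obtain ⟨y, hy, hyd⟩ := Option.bind_eq_some_iff.1 hd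
          exact (ih y ((if_neg hx).trans hy) d hyd).tail (by rw [hgh x hx, hy])
    refine Subrelation.wf (r := InvImage (Relation.TransGen fun y x => g x = some y) Subtype.val)
      (fun {d' d} hd => ?_) (InvImage.wf _ G.transGen)
    obtain ⟨y, hy, hyd⟩ := Option.bind_eq_some_iff.1 hd
    exact Relation.TransGen.tail' (hreach y d' hyd) (by rw [hg d, hy])
  · intro G
    have hacc : ∀ x, (∀ d : Subtype D, ρ x = some d → Acc (fun y x => g x = some y) (d : X)) →
        Acc (fun y x => g x = some y) x := by
      intro x
      induction x using H.induction with
      | _ x ih =>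
        intro hx
        by_cases hDx : D x
        · exact hx ⟨x, hDx⟩ (hD ⟨x, hDx⟩)
        · refine ⟨x, fun y hy => ?_⟩
          rw [hgh x hDx] at hy
          exact ih y ((if_neg hDx).trans hy) fun d hd => hx d (by rw [hρ x hDx, hy]; exact hd)
    have hacc' : ∀ d : Subtype D, Acc (fun y x => g x = some y) (d : X) := by
      intro d
      induction d using G.induction with
      | _ d ih =>
        refine ⟨_, fun y hy => hacc y fun d' hd' => ih d' ?_⟩
        rw [hg d] at hy
        simpa [hy] using hd'
    exact ⟨fun x => hacc x fun d _ => hacc' d⟩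

open Classical in
/-- For a set `D` of states whose successors are `w ∘ δ`, the proportion of permutations `δ` of `D`
making the map absorbing is the proportion of `y ∈ D` for which sending all of `D` to `w y` makes
the map absorbing. -/
theorem card_absorbing_perm_mul_card {X : Type*} [Fintype X] [DecidableEq X] (D : X → Prop)
    [DecidablePred D] (w h : X → Option X) :
    Fintype.card (Subtype D) * (∑ δ : Equiv.Perm (Subtype D),
      if IsAbsorbing (fun x => if D x then w (Equiv.Perm.ofSubtype δ x) else h x) then 1 else 0) =
    (Fintype.card (Subtype D))! * ∑ y : Subtype D,
      if IsAbsorbing (fun x => if D x then w y else h x) then 1 else 0 := by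
  by_cases H : IsAbsorbing fun x => if D x then none else h x
  · obtain ⟨ρ, hD, hρ⟩ := H.exists_landing
    have h1 : ∀ δ : Equiv.Perm (Subtype D),
        IsAbsorbing (fun x => if D x then w (Equiv.Perm.ofSubtype δ x) else h x) ↔
          IsAbsorbing fun d : Subtype D => (fun d : Subtype D => (w d).bind ρ) (δ d) := fun δ =>
      isAbsorbing_iff_landing H hD hρ (γ := fun d => w (δ d)) (fun d => by simp [d.2])
        fun x hx => by simp [hx]
    have h2 : ∀ y : Subtype D,
        IsAbsorbing (fun x => if D x then w y else h x) ↔ (w y).bind ρ = none := fun y => by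
      have : Nonempty (Subtype D) := ⟨y⟩
      rw [← isAbsorbing_const_iff (X := Subtype D)]
      exact isAbsorbing_iff_landing H hD hρ (fun d => by simp [d.2]) fun x hx => by simp [hx]
    simp only [h1, h2]
    cases hm : Fintype.card (Subtype D) with
    | zero =>
      have := Fintype.card_eq_zero_iff.1 hm
      simp
    | succ m =>
      rw [card_absorbing_perm m _ (fun d : Subtype D => (w d).bind ρ) hm, Nat.factorial_succ,
        mul_assoc]
  -- Here some orbit avoids `D` forever, whatever the successors on `D`; both counts vanish.
  · have h1 : ∀ g : X → Option X, (∀ x, ¬ D x → g x = h x) → ¬ IsAbsorbing g := fun g hg G =>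
      H (G.mono fun x y hxy => by
        split_ifs at hxy with hx
        rw [hg x hx, hxy])
    rw [Finset.sum_eq_zero, Finset.sum_eq_zero]
    · simp
    · exact fun y _ => if_neg (h1 _ fun x hx => if_neg hx)
    · exact fun y _ => if_neg (h1 _ fun x hx => if_neg hx)

/-! ### Full cycles as absorbing maps -/

/-- A permutation has a single cycle if and only if cutting the cycle before `b` leaves no cycle. -/
theorem isCycleOn_univ_iff_isAbsorbing {X : Type*} [Finite X] [DecidableEq X] (τ : Equiv.Perm X)
    (b : X) :
    τ.IsCycleOn Set.univ ↔ IsAbsorbing fun x => if τ x = b then none else some (τ x) := by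
  constructor
  · intro hτ
    have key : ∀ (k : ℕ) (x : X), (τ ^ (k + 1)) x = b →
        Acc (fun y x => (if τ x = b then none else some (τ x)) = some y) x := by
      intro k
      induction k with
      | zero =>
        intro x hx
        exact ⟨x, fun y hy => by simp_all⟩
      | succ k ih =>
        intro x hx
        refine ⟨x, fun y hy => ih y ?_⟩
        split_ifs at hy with h
        rw [← Option.some_injective _ hy, ← Equiv.Perm.mul_apply, ← pow_succ]
        exact hx
    refine ⟨fun x => ?_⟩
    obtain ⟨i, hi, -, hib⟩ := (hτ.2 (Set.mem_univ x) (Set.mem_univ b)).exists_pow_eq''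
    obtain ⟨k, rfl⟩ := Nat.exists_eq_succ_of_ne_zero hi.ne'
    exact key k x hib
  · intro H
    have key : ∀ x, τ.SameCycle x b := by
      intro x
      induction x using H.induction with
      | _ x ih =>
        by_cases hx : τ x = b
        · exact ⟨1, by simpa using hx⟩
        · exact Equiv.Perm.sameCycle_apply_left.1 (ih (τ x) (if_neg hx))
    exact ⟨Set.bijOn_univ.2 τ.bijective, fun x _ y _ => (key x).trans (key y).symm⟩

/-! ### From block-preserving permutations to sections -/

theorem factorial_mul_sum_perm {X : Type*} [Fintype X] [DecidableEq X] (D : X → Prop)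
    [DecidablePred D] (F : Equiv.Perm X → ℕ) :
    (Fintype.card (Subtype D))! * ∑ τ, F τ =
      ∑ τ : Equiv.Perm X, ∑ δ : Equiv.Perm (Subtype D), F (τ * Equiv.Perm.ofSubtype δ) := by
  rw [Finset.sum_comm]
  have : ∀ δ : Equiv.Perm (Subtype D),
      ∑ τ : Equiv.Perm X, F (τ * Equiv.Perm.ofSubtype δ) = ∑ τ, F τ := fun δ =>
    Equiv.sum_comp (Equiv.mulRight (Equiv.Perm.ofSubtype δ)) F
  simp [this, Fintype.card_perm]

/-- Exchanging the coordinate `e i` with the fresh value y is an involution on pairs (e, y). -/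
theorem sum_sum_update {K : Type*} [Fintype K] [DecidableEq K] {E : K → Type*}
    [∀ i, Fintype (E i)] (i : K) (F : (∀ i, E i) → ℕ) :
    ∑ e, ∑ y : E i, F (Function.update e i y) = Fintype.card (E i) * ∑ e, F e := by
  let s : (∀ i, E i) × E i → (∀ i, E i) × E i := fun p => (Function.update p.1 i p.2, p.1 i)
  have hs : Function.Involutive s := fun p => by simp [s]
  rw [← Fintype.sum_prod_type' (f := fun e (y : E i) => F (Function.update e i y)),
    ← Equiv.sum_comp hs.toPerm, Fintype.sum_prod_type]
  simp [s, Finset.mul_sum]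

-- One more fibre is converted: `ρ` is reshuffled on fibre i, `e i` is resampled, and
-- `card_absorbing_perm_mul_card` compares the two with everything else fixed.
open Classical in
theorem sum_blockwise_insert {X K : Type*} [Fintype X] [DecidableEq X] [Fintype K]
    [DecidableEq K] (f : X → K) (hf : Function.Surjective f) (w : X → Option X) (J : Finset K)
    {i : K} (hi : i ∉ J) :
    (∑ ρ : Equiv.Perm X, ∑ e : ∀ i, {x // f x = i},
      if (∀ x, f (ρ x) = f x) ∧ IsAbsorbing (fun x => if f x ∈ J then w (e (f x)) else w (ρ x))
        then 1 else 0) =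
    ∑ ρ : Equiv.Perm X, ∑ e : ∀ i, {x // f x = i},
      if (∀ x, f (ρ x) = f x) ∧
        IsAbsorbing (fun x => if f x ∈ insert i J then w (e (f x)) else w (ρ x))
        then 1 else 0 := by
  have hpos : 0 < Fintype.card {x // f x = i} :=
    Fintype.card_pos_iff.2 ⟨⟨_, (hf i).choose_spec⟩⟩
  refine Nat.eq_of_mul_eq_mul_left (Nat.mul_pos hpos
    (Nat.factorial_pos (Fintype.card {x // f x = i}))) ?_
  rw [mul_assoc, factorial_mul_sum_perm (fun x => f x = i),
    mul_comm (Fintype.card _) (Fintype.card _)!, mul_assoc, Finset.mul_sum,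
    Finset.mul_sum (Finset.univ (α := Equiv.Perm X)),
    Finset.mul_sum (Finset.univ (α := Equiv.Perm X))]
  refine Finset.sum_congr rfl fun ρ _ => ?_
  rw [← sum_sum_update (E := fun i => {x // f x = i}) i, Finset.sum_comm, Finset.mul_sum,
    Finset.mul_sum]
  refine Finset.sum_congr rfl fun e _ => ?_
  have hδ : ∀ (δ : Equiv.Perm {x // f x = i}) x, f (Equiv.Perm.ofSubtype δ x) = f x := by
    intro δ x
    by_cases hx : f x = i
    · rw [Equiv.Perm.ofSubtype_apply_of_mem δ hx, hx]
      exact (δ ⟨x, hx⟩).2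
    · rw [Equiv.Perm.ofSubtype_apply_of_not_mem δ hx]
  by_cases hρ : ∀ x, f (ρ x) = f x
  · have h1 : ∀ δ : Equiv.Perm {x // f x = i},
        ((∀ x, f ((ρ * Equiv.Perm.ofSubtype δ) x) = f x) ∧ IsAbsorbing fun x =>
          if f x ∈ J then w (e (f x)) else w ((ρ * Equiv.Perm.ofSubtype δ) x)) ↔
        IsAbsorbing fun x => if f x = i then (fun x => w (ρ x)) (Equiv.Perm.ofSubtype δ x) else
          if f x ∈ J then w (e (f x)) else w (ρ x) := by
      intro δ
      rw [and_iff_right fun x => by rw [Equiv.Perm.mul_apply, hρ, hδ]]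
      refine iff_of_eq (congrArg _ (funext fun x => ?_))
      by_cases hx : f x = i
      · simp [hx, hi]
      · simp only [if_neg hx, Equiv.Perm.mul_apply, Equiv.Perm.ofSubtype_apply_of_not_mem δ hx]
    simp only [h1]
    refine (card_absorbing_perm_mul_card (fun x => f x = i) (fun x => w (ρ x))
      (fun x => if f x ∈ J then w (e (f x)) else w (ρ x))).trans ?_
    congr 1
    -- The comparison yields constants `w (ρ y)`; since `ρ` permutes the fibre, summing over y gives
    -- the same as constants `w y`.
    let ρ' : Equiv.Perm {x // f x = i} := ρ.subtypePerm fun x => by rw [hρ]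
    refine Eq.trans (Finset.sum_congr rfl fun y _ => ?_) (Equiv.sum_comp ρ' _)
    refine if_congr (Iff.trans ?_ (and_iff_right hρ).symm) rfl rfl
    refine iff_of_eq (congrArg _ (funext fun x => ?_))
    by_cases hx : f x = i
    · subst hx
      simp [ρ']
    · simp [hx]
  · have h1 : ∀ δ : Equiv.Perm {x // f x = i},
        ¬ ∀ x, f ((ρ * Equiv.Perm.ofSubtype δ) x) = f x := by
      intro δ H
      refine hρ fun x => ?_
      have := H ((Equiv.Perm.ofSubtype δ)⁻¹ x)
      rw [← hδ δ ((Equiv.Perm.ofSubtype δ)⁻¹ x)] at this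
      simpa using this
    simp only [h1, hρ, false_and, if_false, Finset.sum_const_zero, mul_zero]

open Classical in
/-- Composing `w` with a random permutation preserving the fibres of `f` is absorbing with the same
probability as replacing each fibre by a random one of its points. -/
theorem prod_card_mul_card_absorbing {X K : Type*} [Fintype X] [DecidableEq X] [Fintype K]
    [DecidableEq K] (f : X → K) (hf : Function.Surjective f) (w : X → Option X) :
    (∏ i, Fintype.card {x // f x = i}) * (∑ ρ : Equiv.Perm X,
      if (∀ x, f (ρ x) = f x) ∧ IsAbsorbing (fun x => w (ρ x)) then 1 else 0) =
    (∏ i, (Fintype.card {x // f x = i})!) * ∑ e : ∀ i, {x // f x = i},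
      if IsAbsorbing (fun x => w (e (f x))) then 1 else 0 := by
  have h : ∀ J : Finset K, (∑ ρ : Equiv.Perm X, ∑ e : ∀ i, {x // f x = i},
      if (∀ x, f (ρ x) = f x) ∧ IsAbsorbing (fun x => if f x ∈ (∅ : Finset K) then w (e (f x))
        else w (ρ x)) then 1 else 0) =
    ∑ ρ : Equiv.Perm X, ∑ e : ∀ i, {x // f x = i},
      if (∀ x, f (ρ x) = f x) ∧ IsAbsorbing (fun x => if f x ∈ J then w (e (f x)) else w (ρ x))
        then 1 else 0 := by
    intro J
    induction J using Finset.induction_on with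
    | empty => rfl
    | insert i J hi ih => rw [ih, sum_blockwise_insert f hf w J hi]
  have h := h Finset.univ
  simp only [Finset.notMem_empty, if_false, Finset.mem_univ, if_true] at h
  have hY : (∑ ρ : Equiv.Perm X, if ∀ x, f (ρ x) = f x then 1 else 0) =
      ∏ i, (Fintype.card {x // f x = i})! := by
    rw [← DomMulAct.stabilizer_card f, Fintype.card_subtype, Finset.sum_boole]
    simp [funext_iff]
  rw [← hY, ← Fintype.card_pi, Finset.sum_mul_sum, Finset.mul_sum]
  convert h using 2 with ρ _ ρ _
  · simp
  · refine Finset.sum_congr rfl fun e _ => ?_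
    by_cases hρ : ∀ x, f (ρ x) = f x <;> simp only [hρ, implies_true, true_and, false_and,
      if_true, if_false, one_mul, zero_mul]

/-! ### Marked points and full cycles -/

/-- For a section `e` of a colouring, a permutation `τ` and a point `a`: follow `τ` from the marked
point `e (f x)` of the colour of `x`, stopping at `a`. -/
def sectionStep {X K : Type*} [DecidableEq X] (f : X → K) (e : K → X) (a : X)
    (τ : Equiv.Perm X) (x : X) : Option X :=
  if e (f x) = a then none else some (τ (e (f x)))

theorem apply_section_eq_iff {X K : Type*} {f : X → K} {e : K → X} {a : X}
    (he : ∀ i, f (e i) = i) (ha : e (f a) = a) (x : X) :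
    e (f x) = a ↔ f x = f a := by
  constructor
  · intro h
    rw [← h, he]
  · intro h
    rw [h, ha]

section

variable {X K : Type*} [DecidableEq X] {f : X → K} {e : K → X} {a : X}

/-- The two maps compose `τ` and `e ∘ f` in opposite orders, so each factor carries orbits of one to
orbits of the other. With `τ` applied first, `card_absorbing_perm` applies. -/
theorem isAbsorbing_sectionStep_iff [DecidableEq K] (he : ∀ i, f (e i) = i) (ha : e (f a) = a)
    (τ : Equiv.Perm X) :
    IsAbsorbing (sectionStep f e a τ) ↔
      IsAbsorbing fun x => (fun y => if f y = f a then none else some (e (f y))) (τ x) := by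
  have hea := apply_section_eq_iff he ha
  constructor <;> intro H
  · refine H.of_hom τ fun x y hxy => Or.inr ?_
    simp only at hxy
    split_ifs at hxy with h
    rw [sectionStep, if_neg (mt (hea _).1 h), Option.some_injective _ hxy]
  · refine H.of_hom (fun x => e (f x)) fun x y hxy => ?_
    rw [sectionStep] at hxy
    split_ifs at hxy with h
    rw [Option.some_injective _ hxy]
    by_cases hy : f y = f a
    · exact Or.inl (if_pos ((hea y).2 hy))
    · exact Or.inr (if_neg hy)

open Classical in
theorem card_absorbing_sectionStep [Fintype X] [DecidableEq K] (he : ∀ i, f (e i) = i)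
    (ha : e (f a) = a) {m : ℕ} (hm : Fintype.card X = m + 1) :
    (∑ τ : Equiv.Perm X, if IsAbsorbing (sectionStep f e a τ) then 1 else 0) =
      m ! * Fintype.card {x // f x = f a} := by
  simp only [isAbsorbing_sectionStep_iff he ha]
  rw [card_absorbing_perm m X (fun y => if f y = f a then none else some (e (f y))) hm,
    Fintype.card_subtype, Finset.sum_boole]
  simp

/-- Cutting before `τ a` makes the stopping condition `δ x = a`, free of `τ`. -/
theorem isCycleOn_mul_iff_isAbsorbing [Finite X] (τ δ : Equiv.Perm X) :
    (τ * δ).IsCycleOn Set.univ ↔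
      IsAbsorbing fun x => (fun y => if y = a then none else some (τ y)) (δ x) := by
  rw [isCycleOn_univ_iff_isAbsorbing _ (τ a)]
  simp

open Classical in
/-- Among the permutations for which a section leads every point to `a`, one in
`|X| + 1 - |K|` is a single cycle. -/
theorem card_mul_card_isCycleOn_sectionStep [Fintype X] (he : ∀ i, f (e i) = i) :
    Fintype.card {x // x = a ∨ e (f x) ≠ x} * (∑ τ : Equiv.Perm X,
      if τ.IsCycleOn Set.univ ∧ IsAbsorbing (sectionStep f e a τ) then 1 else 0) =
    ∑ τ : Equiv.Perm X, if IsAbsorbing (sectionStep f e a τ) then 1 else 0 := by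
  have hX : Nonempty X := ⟨a⟩
  -- The section map reads `τ` only at marked points other than `a`, that is, off `D`; reshuffling
  -- `τ` on `D` leaves it unchanged.
  let D : X → Prop := fun x => x = a ∨ e (f x) ≠ x
  change Fintype.card (Subtype D) * _ = _
  refine Nat.eq_of_mul_eq_mul_left (Nat.factorial_pos (Fintype.card (Subtype D))) ?_
  rw [mul_left_comm, factorial_mul_sum_perm D, Finset.mul_sum, Finset.mul_sum]
  refine Finset.sum_congr rfl fun τ _ => ?_
  have h1 : ∀ δ : Equiv.Perm (Subtype D),
      sectionStep f e a (τ * Equiv.Perm.ofSubtype δ) = sectionStep f e a τ := by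
    intro δ
    funext x
    by_cases hx : e (f x) = a
    · simp [sectionStep, hx]
    · have : ¬ D (e (f x)) := by simp [D, hx, he]
      simp [sectionStep, Equiv.Perm.ofSubtype_apply_of_not_mem δ this]
  simp only [h1]
  by_cases hT : IsAbsorbing (sectionStep f e a τ)
  · simp only [hT, and_true, if_true]
    have h2 : ∀ δ : Equiv.Perm (Subtype D),
        (τ * Equiv.Perm.ofSubtype δ).IsCycleOn Set.univ ↔
        IsAbsorbing fun x => if D x then (fun y => if y = a then none else some (τ y))
          (Equiv.Perm.ofSubtype δ x) else some (τ x) := by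
      intro δ
      rw [isCycleOn_mul_iff_isAbsorbing (a := a)]
      refine iff_of_eq (congrArg _ (funext fun x => ?_))
      by_cases hx : D x
      · simp [hx]
      · have : x ≠ a := fun h => hx (Or.inl h)
        simp [hx, Equiv.Perm.ofSubtype_apply_of_not_mem δ hx, this]
    -- Sending `D` to `w y` with y ≠ a leaves no stopping point; with y = a only steps of the
    -- section map remain.
    have h3 : ∀ y : Subtype D,
        (IsAbsorbing fun x => if D x then (fun y => if y = a then none else some (τ y)) y.1 else
          some (τ x)) ↔ y = ⟨a, Or.inl rfl⟩ := by
      intro y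
      constructor
      · intro H
        obtain ⟨x, hx⟩ := H.exists_eq_none
        by_contra hy
        have : y.1 ≠ a := fun h => hy (Subtype.ext h)
        simp only [this, if_false] at hx
        split_ifs at hx
      · rintro rfl
        refine hT.mono fun x y hxy => ?_
        by_cases hx : D x
        · simp [hx] at hxy
        · have hx' := not_or.1 hx
          rw [not_not] at hx'
          rw [sectionStep, hx'.2, if_neg hx'.1]
          simpa [hx] using hxy
    simp only [h2]
    rw [card_absorbing_perm_mul_card D (fun y => if y = a then none else some (τ y))]
    simp only [h3]
    simp
  · simp [hT]

/-- Marked points other than `a` correspond to colours other than `f a`; this is the source of the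
denominator n + 1 - k. -/
theorem card_unmarked_add [Fintype X] [Fintype K] [DecidableEq K] (he : ∀ i, f (e i) = i)
    (ha : e (f a) = a) :
    Fintype.card {x // x = a ∨ e (f x) ≠ x} + Fintype.card K = Fintype.card X + 1 := by
  have hinj : Function.Injective e := Function.LeftInverse.injective he
  have h1 : (Finset.univ.filter fun x => ¬ (x = a ∨ e (f x) ≠ x)) =
      (Finset.univ.erase (f a)).image e := by
    ext x
    simp only [Finset.mem_filter, Finset.mem_univ, true_and, Finset.mem_image, Finset.mem_erase,
      and_true, not_or, not_not]
    constructor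
    · rintro ⟨h, h'⟩
      exact ⟨f x, fun hx => h (by rw [← h', hx, ha]), h'⟩
    · rintro ⟨i, hi, rfl⟩
      exact ⟨fun h => hi (by rw [← h, he]), by rw [he]⟩
  have h2 := Finset.card_filter_add_card_filter_not (s := (Finset.univ : Finset X))
    (fun x => x = a ∨ e (f x) ≠ x)
  rw [h1, Finset.card_image_of_injective _ hinj, Finset.card_erase_of_mem (Finset.mem_univ _),
    Finset.card_univ, Finset.card_univ] at h2
  have h3 : 0 < Fintype.card K := Fintype.card_pos_iff.2 ⟨f a⟩
  rw [Fintype.card_subtype]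
  omega

end

/-! ### Double counting over cycles and sections -/

open Classical in
/-- The number of pairs of full cycles that differ by a permutation preserving the fibres of `f`. -/
theorem card_isCycleOn_pair {X K : Type*} [Fintype X] [DecidableEq X] [Fintype K]
    [DecidableEq K] (f : X → K) (hf : Function.Surjective f) {m : ℕ}
    (hm : Fintype.card X = m + 1) :
    (m + 2 - Fintype.card K) * (∑ τ : Equiv.Perm X, ∑ ρ : Equiv.Perm X,
      if τ.IsCycleOn Set.univ ∧ (∀ x, f (ρ x) = f x) ∧ (τ * ρ).IsCycleOn Set.univ
        then 1 else 0) =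
    m ! * ∏ i, (Fintype.card {x // f x = i})! := by
  obtain ⟨a⟩ : Nonempty X := Fintype.card_pos_iff.1 (by omega)
  have hpos : 0 < ∏ i, Fintype.card {x // f x = i} := Finset.prod_pos fun i _ =>
    Fintype.card_pos_iff.2 ⟨⟨_, (hf i).choose_spec⟩⟩
  have h1 : ∀ τ : Equiv.Perm X, (∏ i, Fintype.card {x // f x = i}) * (∑ ρ : Equiv.Perm X,
      if τ.IsCycleOn Set.univ ∧ (∀ x, f (ρ x) = f x) ∧ (τ * ρ).IsCycleOn Set.univ
        then 1 else 0) =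
      (∏ i, (Fintype.card {x // f x = i})!) * ∑ e : ∀ i, {x // f x = i},
        if τ.IsCycleOn Set.univ ∧ IsAbsorbing (sectionStep f (fun i => e i) a τ)
          then 1 else 0 := by
    intro τ
    by_cases hτ : τ.IsCycleOn Set.univ
    · simp only [hτ, true_and, isCycleOn_mul_iff_isAbsorbing (a := a) τ]
      exact prod_card_mul_card_absorbing f hf fun y => if y = a then none else some (τ y)
    · simp [hτ]
  have h2 : ∀ e : ∀ i, {x // f x = i},
      (m + 2 - Fintype.card K) * (∑ τ : Equiv.Perm X,
        if τ.IsCycleOn Set.univ ∧ IsAbsorbing (sectionStep f (fun i => e i) a τ)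
          then 1 else 0) =
      m ! * (Fintype.card {x // f x = f a} * if e (f a) = ⟨a, rfl⟩ then 1 else 0) := by
    intro e
    have he : ∀ i, f (e i) = i := fun i => (e i).2
    by_cases ha : e (f a) = ⟨a, rfl⟩
    · have ha' : (e (f a) : X) = a := congrArg Subtype.val ha
      have h := card_mul_card_isCycleOn_sectionStep (a := a) (e := fun i => (e i : X)) he
      have h' := card_unmarked_add (e := fun i => (e i : X)) he ha'
      rw [if_pos ha, mul_one, ← card_absorbing_sectionStep (e := fun i => (e i : X)) he ha' hm, ← h]
      congr 1
      rw [show m + 2 - Fintype.card K = Fintype.card {x // x = a ∨ (e (f x) : X) ≠ x} by omega]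
    -- If `a` is not marked, the section map never stops.
    · have h : ∀ τ, ¬ IsAbsorbing (sectionStep f (fun i => (e i : X)) a τ) := by
        intro τ H
        have : Nonempty X := ⟨a⟩
        obtain ⟨x, hx⟩ := H.exists_eq_none
        rw [sectionStep] at hx
        split_ifs at hx with h
        have hfx : f x = f a := by rw [← h, he]
        rw [hfx] at h
        exact ha (Subtype.ext h)
      simp [h, ha]
  -- Resampling `e (f a)` shows that one section in |fibre of a| marks `a`, which cancels the fibre
  -- size in `h2`.
  have h3 : (Fintype.card {x // f x = f a}) * (∑ e : ∀ i, {x // f x = i},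
      if e (f a) = ⟨a, rfl⟩ then 1 else 0) = ∏ i, Fintype.card {x // f x = i} := by
    rw [← sum_sum_update (E := fun i => {x // f x = i}) (f a), ← Fintype.card_pi]
    simp
  refine Nat.eq_of_mul_eq_mul_left hpos ?_
  rw [mul_left_comm, Finset.mul_sum]
  simp only [h1]
  rw [← Finset.mul_sum, Finset.sum_comm, mul_left_comm, Finset.mul_sum]
  simp only [h2]
  rw [← Finset.mul_sum, ← Finset.mul_sum, h3]
  ring

/-! ### Compositions and the final formula -/

theorem mem_compositionBlock_iff {n : ℕ} (α : Composition n) (i : Fin α.length) (x : Fin n) :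
    x ∈ compositionBlock α i ↔ α.index x = i := by
  rw [eq_comm, ← α.mem_range_embedding_iff', α.mem_range_embedding_iff, compositionBlock,
    Set.mem_ofPred_eq, ← α.sizeUpTo_succ']

theorem isSeparatedBy_iff {n : ℕ} (α : Composition n) (π : Equiv.Perm (Fin n)) :
    IsSeparatedBy α π ↔ ∀ x, α.index (π x) = α.index x := by
  constructor
  · intro h x
    obtain ⟨i, hi⟩ := h x
    have h1 := (mem_compositionBlock_iff α i _).1 (hi (Equiv.Perm.SameCycle.refl π x))
    have h2 : π.SameCycle x (π x) := ⟨1, by simp⟩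
    rw [(mem_compositionBlock_iff α i _).1 (hi h2), h1]
  · intro h x
    refine ⟨α.index x, fun y hy => (mem_compositionBlock_iff α _ _).2 ?_⟩
    obtain ⟨k, rfl⟩ := hy.exists_nat_pow_eq
    induction k with
    | zero => rfl
    | succ k ih =>
      rw [pow_succ', Equiv.Perm.mul_apply, h]
      exact ih ⟨k, by simp⟩

theorem card_index_fiber {n : ℕ} (α : Composition n) (i : Fin α.length) :
    Fintype.card {x // α.index x = i} = α.blocksFun i := by
  have h : {x | α.index x = i} = Set.range (α.embedding i) := by
    ext x
    rw [α.mem_range_embedding_iff', Set.mem_ofPred_eq, eq_comm]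
  rw [← Nat.card_eq_fintype_card]
  change Nat.card {x | α.index x = i} = _
  rw [h, Nat.card_range_of_injective (α.embedding i).injective, Nat.card_fin]

theorem index_surjective {n : ℕ} (α : Composition n) : Function.Surjective α.index := fun i =>
  ⟨α.embedding i ⟨0, α.blocks_pos' i i.2⟩, α.index_embedding i _⟩

theorem isLongCycle_inv {n : ℕ} {s : Equiv.Perm (Fin n)} : IsLongCycle s⁻¹ ↔ IsLongCycle s :=
  Equiv.Perm.isCycleOn_inv

-- Substitute s = (tρ)⁻¹, so that st = ρ⁻¹; inversion preserves both full cycles and separation.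
open Classical in
theorem separatedPairCount_eq_sum {n : ℕ} (α : Composition n) :
    separatedPairCount α = ∑ τ : Equiv.Perm (Fin n), ∑ ρ : Equiv.Perm (Fin n),
      if τ.IsCycleOn Set.univ ∧ (∀ x, α.index (ρ x) = α.index x) ∧
        (τ * ρ).IsCycleOn Set.univ then 1 else 0 := by
  rw [separatedPairCount, Nat.card_eq_fintype_card, Fintype.card_subtype, Finset.card_filter,
    Fintype.sum_prod_type_right]
  refine Finset.sum_congr rfl fun t _ => ?_
  rw [← Equiv.sum_comp ((Equiv.mulLeft t).trans (Equiv.inv (Equiv.Perm (Fin n))))]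
  refine Finset.sum_congr rfl fun ρ _ => if_congr ?_ rfl rfl
  have h1 : ((Equiv.mulLeft t).trans (Equiv.inv (Equiv.Perm (Fin n)))) ρ = (t * ρ)⁻¹ := rfl
  have h2 : (t * ρ)⁻¹ * t = ρ⁻¹ := by simp
  have h3 : (∀ x, α.index (ρ⁻¹ x) = α.index x) ↔ ∀ x, α.index (ρ x) = α.index x :=
    ⟨fun h x => by simpa using (h (ρ x)).symm, fun h x => by simpa using (h (ρ⁻¹ x)).symm⟩
  rw [h1, h2, isLongCycle_inv, isSeparatedBy_iff, h3, IsLongCycle, IsLongCycle]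
  tauto

theorem separatedPairCount_mul {n : ℕ} (hn : 0 < n) (α : Composition n) :
    (n + 1 - α.length) * separatedPairCount α = (n - 1)! * ∏ i, (α.blocksFun i)! := by
  obtain ⟨m, rfl⟩ := Nat.exists_eq_succ_of_ne_zero hn.ne'
  have h := card_isCycleOn_pair α.index (index_surjective α) (Fintype.card_fin (m + 1))
  rw [separatedPairCount_eq_sum]
  simp only [card_index_fiber, Fintype.card_fin] at h
  convert h
  simp

theorem mainTheorem7 (n : ℕ) (hn : 0 < n) (α : Composition n) :
    (separatedPairCount α : ℚ) =
        (∏ i : Fin α.length, ((α.blocksFun i)! : ℚ)) / ((n + 1 - α.length)! : ℚ)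
          * ((n - 1)! : ℚ) * ((n - α.length)! : ℚ) ∧
      (separatedPairCount α : ℚ) =
        ((n - 1)! : ℚ) * (∏ i : Fin α.length, ((α.blocksFun i)! : ℚ))
          / ((n : ℚ) + 1 - (α.length : ℚ)) := by
  have hk := α.length_le
  have h : (((n + 1 - α.length) * separatedPairCount α : ℕ) : ℚ) = _ :=
    congrArg Nat.cast (separatedPairCount_mul hn α)
  obtain ⟨d, hd⟩ := Nat.exists_eq_add_of_le hk
  have h1 : n + 1 - α.length = d + 1 := by omega
  have h2 : n - α.length = d := by omega
  have h3 : (n : ℚ) + 1 - α.length = d + 1 := by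
    rw [show (n : ℚ) = α.length + d by exact_mod_cast hd]
    ring
  rw [h1] at h ⊢
  rw [h2, h3, Nat.factorial_succ]
  push_cast at h ⊢
  have h4 : (d : ℚ) + 1 ≠ 0 := by positivity
  have h5 : (d ! : ℚ) ≠ 0 := by positivity
  constructor
  · field_simp
    linarith
  · field_simp
    linarith
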